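/- Let $\mathcal T$ be a finite tree with $n\ge 2$ vertices (the seed), let $m\ge 0$ be an integer, and let $\mathcal W_{\mathcal T}=\frac12\sum_{u,v}d_{uv}$ be its Wiener index, where $d_{uv}$ is the graph distance. Type-II growth of order $m$ turns a finite graph into the graph obtained by attaching $m k_u$ new leaves to each vertex $u$, where $k_u$ is the degree of $u$. Put $\mathcal T^{\mathrm{II}}_m(0)=\mathcal T$ and let $\mathcal T^{\mathrm{II}}_m(t)$ be the result of applying Type-II growth of order $m$ to $\mathcal T^{\mathrm{II}}_m(t-1)$, for $t\ge 1$; write $|\mathcal T^{\mathrm{II}}_m(t)|$ for its number of vertices. For a connected graph $\mathcal G$ with $N\ge 2$ vertices, let $\mathcal H_{u\to v}$ be the expected first time $k\ge 0$ at which the simple random walk started at $u$ (each step goes to a uniformly chosen neighbour) is at $v$, and let $\langle\mathcal H_{\mathcal G}\rangle=\frac{1}{N(N-1)}\sum_{u,v}\mathcal H_{u\to v}$ be the mean hitting time. Then for every integer $t\ge 0$ the graph $\mathcal T^{\mathrm{II}}_m(t)$ is a tree, $|\mathcal T^{\mathrm{II}}_m(t)|=(n-1)(2m+1)^t+1$,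 all its hitting times are finite, and $$\langle\mathcal H_{\mathcal T^{\mathrm{II}}_m(t)}\rangle=\frac{2}{|\mathcal T^{\mathrm{II}}_m(t)|}\Big\{f_2^{\,t}\,\mathcal W_{\mathcal T}+g_2\sum_{i=0}^{t-1}f_2^{\,i}\,|\mathcal T^{\mathrm{II}}_m(t-1-i)|^2-h_2\sum_{i=0}^{t-1}f_2^{\,i}\,|\mathcal T^{\mathrm{II}}_m(t-1-i)|+l_2\sum_{i=0}^{t-1}f_2^{\,i}\Big\},$$ where $f_2=(2m+1)^2$, $g_2=m(2m+1)$, $h_2=m(5m+3)$ and $l_2=m(3m+2)$. -/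

import Mathlib

open MeasureTheory ProbabilityTheory
open scoped ENNReal

universe u

/-- A finite simple graph, bundled with its vertex type. -/
structure FinGraph : Type (u + 1) where
  V : Type u
  [fintypeV : Fintype V]
  graph : SimpleGraph V

namespace FinGraph

instance (T : FinGraph.{u}) : Fintype T.V := T.fintypeV

/-- The vertex set is finite, so it carries the discrete σ-algebra. -/
instance (T : FinGraph.{u}) : MeasurableSpace T.V := ⊤

instance (T : FinGraph.{u}) : DiscreteMeasurableSpace T.V := ⟨fun _ => trivial⟩

/-- The number of vertices. -/
def order (T : FinGraph.{u}) : ℕ := Fintype.card T.V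

open Classical in
/-- The degree of a vertex. -/
noncomputable def deg (T : FinGraph.{u}) (u : T.V) : ℕ := T.graph.degree u

/-- The Wiener index: half the sum of the distances over all ordered pairs of vertices. -/
noncomputable def wiener (T : FinGraph.{u}) : ℝ :=
  (1 / 2) * ∑ u : T.V, ∑ v : T.V, (T.graph.dist u v : ℝ)

/-- Adjacency after attaching `m * deg u` new leaves to each vertex `u`. -/
inductive GrowAdj (m : ℕ) (T : FinGraph.{u}) :
    T.V ⊕ (Σ u : T.V, Fin (m * T.deg u)) → T.V ⊕ (Σ u : T.V, Fin (m * T.deg u)) → Prop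
  | old {u v : T.V} (h : T.graph.Adj u v) : GrowAdj m T (Sum.inl u) (Sum.inl v)
  | down (u : T.V) (i : Fin (m * T.deg u)) : GrowAdj m T (Sum.inl u) (Sum.inr ⟨u, i⟩)
  | up (u : T.V) (i : Fin (m * T.deg u)) : GrowAdj m T (Sum.inr ⟨u, i⟩) (Sum.inl u)

/-- The Type-II growth operation of order `m`: every vertex `u` of degree `k` receives `m * k`
new pendant vertices. -/
noncomputable def growII (m : ℕ) (T : FinGraph.{u}) : FinGraph.{u} where
  V := T.V ⊕ (Σ u : T.V, Fin (m * T.deg u))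
  graph :=
    { Adj := GrowAdj m T
      symm := by
        constructor
        intro a b h
        cases h with
        | old h => exact .old h.symm
        | down u i => exact .up u i
        | up u i => exact .down u i
      loopless := by
        constructor
        intro a h
        cases h with
        | old h => exact T.graph.loopless.irrefl _ h }

/-- The tree obtained from the seed `T` after `t` rounds of Type-II growth of order `m`. -/
noncomputable def treeII (m : ℕ) (T : FinGraph.{u}) : ℕ → FinGraph.{u}
  | 0 => T
  | t + 1 => growII m (treeII m T t)

open Classical in
/-- One step of the unbiased random walk: from `u` the walker moves to a uniformly chosen
neighbour. (At an isolated vertex, which does not occur in a tree with at least two vertices,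
the walker stays put.) -/
noncomputable def stepPMF (T : FinGraph.{u}) (u : T.V) : PMF T.V :=
  if h : (T.graph.neighborFinset u).Nonempty then
    PMF.uniformOfFinset (T.graph.neighborFinset u) h
  else PMF.pure u

/-- The transition kernel of the walk at time `k`: it depends on the history only through the
current position. -/
noncomputable def stepKernel (T : FinGraph.{u}) (k : ℕ) :
    Kernel (Π _ : Finset.Iic k, T.V) T.V where
  toFun x := (T.stepPMF (x ⟨k, Finset.mem_Iic.2 le_rfl⟩)).toMeasure
  measurable' := (measurable_of_countable fun u : T.V => (T.stepPMF u).toMeasure).comp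
    (measurable_pi_apply _)

instance (T : FinGraph.{u}) (k : ℕ) : IsMarkovKernel (T.stepKernel k) :=
  ⟨fun x => PMF.toMeasure.isProbabilityMeasure
    (T.stepPMF (x ⟨k, Finset.mem_Iic.2 le_rfl⟩))⟩

/-- The law, on the space of trajectories, of the unbiased random walk started at `u`. -/
noncomputable def walkLaw (T : FinGraph.{u}) (u : T.V) : Measure (ℕ → T.V) :=
  Kernel.trajMeasure (X := fun _ => T.V) (Measure.dirac u) T.stepKernel

/-- The hitting time from `u` to `v`: the expected value of the first time `k ≥ 0` at which the
walk started at `u` is at `v` (that time is `∞` on trajectories that never visit `v`). -/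
noncomputable def hittingTime (T : FinGraph.{u}) (u v : T.V) : ℝ≥0∞ :=
  ∫⁻ ω, (⨅ (k : ℕ) (_ : ω k = v), (k : ℝ≥0∞)) ∂(T.walkLaw u)

/-- The mean hitting time: the average of the hitting times over the `N (N - 1)` ordered pairs of
distinct vertices (the diagonal terms of the sum vanish, since the walk from `u` is at `u` at
time `0`). -/
noncomputable def meanHittingTime (T : FinGraph.{u}) : ℝ :=
  1 / ((T.order : ℝ) * ((T.order : ℝ) - 1)) *
    ∑ u : T.V, ∑ v : T.V, (T.hittingTime u v).toReal

end FinGraph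

/-!
A bounded function that vanishes at `v` and solves the first-step equation elsewhere is the expected
time to hit `v`. On a tree with `N` vertices, moving from `w` to a neighbour increases the distance
to `z` by one, except along a single edge if `w ≠ z`; hence the sum of the increments of `dist z`
over the neighbours of `w` is `deg w - 2`, plus `2` if `w = z`. Consequently
`(N - 1) * dist u v + s v - s u`, where `s` is the sum of the distances to all vertices, solves the
first-step equation, and averaging it gives `2 / N` times the Wiener index.

Type-II growth keeps the distances between old vertices, and every distance to a new leaf is one
more than the distance to its root. The new Wiener index thus only involves sums of distances
weighted by degrees, which in a tree reduce to unweighted ones. This gives a linear recurrence.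
-/

section LinearRecurrence

theorem eq_pow_mul_add_sum_of_succ_eq {R : Type*} [Semiring R] {x c : ℕ → R} {r : R}
    (hx : ∀ t, x (t + 1) = r * x t + c t) (t : ℕ) :
    x t = r ^ t * x 0 + ∑ i ∈ Finset.range t, r ^ i * c (t - 1 - i) := by
  induction t with
  | zero => simp
  | succ t ih =>
    have hshift : ∀ i, r ^ (i + 1) * c (t - (i + 1)) = r * (r ^ i * c (t - 1 - i)) := fun i => by
      rw [pow_succ', mul_assoc, Nat.sub_sub, add_comm i]
    rw [hx, ih, Finset.sum_range_succ', mul_add, Finset.mul_sum]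
    simp_rw [Nat.add_sub_cancel, hshift]
    rw [pow_succ', mul_assoc, pow_zero, one_mul, Nat.sub_zero, add_assoc]

end LinearRecurrence

section FirstVisit

variable {E : Type*}

/-- The first time `k ≥ 0` at which the trajectory `ω` is in `A`; it is `∞` if `ω` never visits
`A`. -/
noncomputable def firstVisit (A : Set E) (ω : ℕ → E) : ℝ≥0∞ :=
  ⨅ (k : ℕ) (_ : ω k ∈ A), (k : ℝ≥0∞)

/-- The event that a trajectory stays outside `A` up to and including time `n`. -/
def avoiding (A : Set E) (n : ℕ) : Set (ℕ → E) :=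
  {ω | ∀ k ≤ n, ω k ∉ A}

lemma mem_avoiding_succ_iff {A : Set E} {n : ℕ} {ω : ℕ → E} :
    ω ∈ avoiding A (n + 1) ↔ ω ∈ avoiding A n ∧ ω (n + 1) ∉ A :=
  ⟨fun h => ⟨fun k hk => h k (hk.trans n.le_succ), h _ le_rfl⟩,
    fun h k hk => (Nat.le_succ_iff.1 hk).elim (h.1 k) fun hk => hk ▸ h.2⟩

lemma avoiding_eq_preimage_frestrictLe (A : Set E) (n : ℕ) :
    avoiding A n =
      Preorder.frestrictLe (π := fun _ => E) n ⁻¹' {h | ∀ k : Finset.Iic n, h k ∉ A} := by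
  ext ω
  simp [avoiding]

lemma firstVisit_eq_tsum_indicator (A : Set E) (ω : ℕ → E) :
    firstVisit A ω = ∑' n, (avoiding A n).indicator 1 ω := by
  classical
  by_cases hvisit : ∃ k, ω k ∈ A
  · have hmem : ∀ n, ω ∈ avoiding A n ↔ n ∈ Finset.range (Nat.find hvisit) := fun n => by
      rw [Finset.mem_range, Nat.lt_find_iff]
      rfl
    calc firstVisit A ω = (Nat.find hvisit : ℕ) :=
          le_antisymm (iInf₂_le (Nat.find hvisit) (Nat.find_spec hvisit))
            (le_iInf₂ fun k hk => Nat.cast_le.2 (Nat.find_min' hvisit hk))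
      _ = ∑ _n ∈ Finset.range (Nat.find hvisit), 1 := by simp
      _ = ∑ n ∈ Finset.range (Nat.find hvisit), (avoiding A n).indicator 1 ω :=
          Finset.sum_congr rfl fun n hn => by
            rw [Set.indicator_of_mem ((hmem n).2 hn), Pi.one_apply]
      _ = ∑' n, (avoiding A n).indicator 1 ω :=
          (tsum_eq_sum fun n hn => Set.indicator_of_notMem (mt (hmem n).1 hn) _).symm
  · push Not at hvisit
    have hmem : ∀ n, ω ∈ avoiding A n := fun n k _ => hvisit k
    simp [firstVisit, hvisit, hmem]

variable [MeasurableSpace E] {A : Set E}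

lemma measurableSet_forall_notMem (hA : MeasurableSet A) (n : ℕ) :
    MeasurableSet {h : Π _ : Finset.Iic n, E | ∀ k, h k ∉ A} := by
  rw [Set.ofPred_forall]
  exact .iInter fun k => (measurable_pi_apply k hA).compl

lemma measurableSet_avoiding (hA : MeasurableSet A) (n : ℕ) : MeasurableSet (avoiding A n) := by
  rw [avoiding_eq_preimage_frestrictLe]
  exact Preorder.measurable_frestrictLe n (measurableSet_forall_notMem hA n)

lemma lintegral_firstVisit (μ : Measure (ℕ → E)) (hA : MeasurableSet A) :
    ∫⁻ ω, firstVisit A ω ∂μ = ∑' n, μ (avoiding A n) := by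
  simp_rw [firstVisit_eq_tsum_indicator]
  rw [lintegral_tsum fun n => (measurable_one.indicator (measurableSet_avoiding hA n)).aemeasurable]
  simp_rw [lintegral_indicator_one (measurableSet_avoiding hA _)]

end FirstVisit

section TrajMeasure

variable {X : ℕ → Type*} [∀ n, MeasurableSpace (X n)] (μ₀ : Measure (X 0))
  (κ : (n : ℕ) → Kernel (Π i : Finset.Iic n, X i) (X (n + 1))) [∀ n, IsMarkovKernel (κ n)]

lemma map_eval_zero_trajMeasure :
    (Kernel.trajMeasure μ₀ κ).map (fun ω => ω 0) = μ₀ := by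
  have heval : (fun ω : Π n, X n => ω 0) =
      (fun h : Π i : Finset.Iic 0, X i => h ⟨0, Finset.mem_Iic.2 le_rfl⟩) ∘
        Preorder.frestrictLe 0 := rfl
  rw [heval, ← Measure.map_map (by fun_prop) (by fun_prop), Kernel.trajMeasure,
    Measure.map_comp _ _ (by fun_prop), Kernel.traj_map_frestrictLe, Kernel.partialTraj_self,
    Measure.id_comp]
  exact (Measure.map_map (by fun_prop) (by fun_prop)).trans Measure.map_id

lemma setLIntegral_trajMeasure_succ [IsProbabilityMeasure μ₀] {n : ℕ}
    {s : Set (Π i : Finset.Iic n, X i)} (hs : MeasurableSet s) {φ : X (n + 1) → ℝ≥0∞}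
    (hφ : Measurable φ) :
    ∫⁻ ω in Preorder.frestrictLe n ⁻¹' s, φ (ω (n + 1)) ∂Kernel.trajMeasure μ₀ κ =
      ∫⁻ ω in Preorder.frestrictLe n ⁻¹' s, ∫⁻ y, φ y ∂κ n (Preorder.frestrictLe n ω)
        ∂Kernel.trajMeasure μ₀ κ := by
  have hpair := Kernel.map_frestrictLe_trajMeasure_compProd_eq_map_trajMeasure
    (μ₀ := μ₀) (κ := κ) (a := n)
  calc ∫⁻ ω in Preorder.frestrictLe n ⁻¹' s, φ (ω (n + 1)) ∂Kernel.trajMeasure μ₀ κ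
      = ∫⁻ p in s ×ˢ Set.univ, φ p.2
          ∂(Kernel.trajMeasure μ₀ κ).map fun ω => (Preorder.frestrictLe n ω, ω (n + 1)) := by
        rw [setLIntegral_map (hs.prod .univ) (by fun_prop) (by fun_prop), Set.mk_preimage_prod,
          Set.preimage_univ, Set.inter_univ]
    _ = ∫⁻ h in s, ∫⁻ y, φ y ∂κ n h
          ∂(Kernel.trajMeasure μ₀ κ).map (Preorder.frestrictLe n) := by
        rw [← hpair, Measure.setLIntegral_compProd (by fun_prop) hs .univ]
        simp_rw [Measure.restrict_univ]
    _ = _ := setLIntegral_map hs (hφ.lintegral_kernel) (by fun_prop)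

end TrajMeasure

section FirstStepEquation

open Filter Topology

variable {E : Type*} [MeasurableSpace E] (μ₀ : Measure E)
  (κ : (n : ℕ) → Kernel (Π _ : Finset.Iic n, E) E) [∀ n, IsMarkovKernel (κ n)]

/-- The law of the process on `E` started from `μ₀` whose step at time `n`, given the history up to
then, is drawn from `κ n`. -/
noncomputable def processLaw : Measure (ℕ → E) :=
  Kernel.trajMeasure (X := fun _ => E) μ₀ κ

variable {A : Set E} {φ : E → ℝ≥0∞}

lemma lintegral_processLaw_zero (hφ : Measurable φ) :
    ∫⁻ ω, φ (ω 0) ∂processLaw μ₀ κ = ∫⁻ x, φ x ∂μ₀ := by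
  have hmap : (processLaw μ₀ κ).map (fun ω => ω 0) = μ₀ :=
    map_eval_zero_trajMeasure (X := fun _ => E) μ₀ κ
  rw [← lintegral_map hφ (measurable_pi_apply 0), hmap]

variable [IsProbabilityMeasure μ₀]

lemma setLIntegral_avoiding_processLaw_succ (hA : MeasurableSet A) (hφ : Measurable φ) (n : ℕ) :
    ∫⁻ ω in avoiding A n, φ (ω (n + 1)) ∂processLaw μ₀ κ =
      ∫⁻ ω in avoiding A n, ∫⁻ y, φ y ∂κ n (fun k => ω k) ∂processLaw μ₀ κ := by
  rw [avoiding_eq_preimage_frestrictLe]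
  exact setLIntegral_trajMeasure_succ (X := fun _ => E) (n := n) μ₀ κ
    (measurableSet_forall_notMem hA n) hφ

lemma setLIntegral_avoiding_eq_measure_add (hA : MeasurableSet A) (hφ : Measurable φ)
    (hφA : ∀ x ∈ A, φ x = 0) {n : ℕ}
    (hstep : ∀ h : Π _ : Finset.Iic n, E, h ⟨n, Finset.mem_Iic.2 le_rfl⟩ ∉ A →
      1 + ∫⁻ y, φ y ∂κ n h = φ (h ⟨n, Finset.mem_Iic.2 le_rfl⟩)) :
    ∫⁻ ω in avoiding A n, φ (ω n) ∂processLaw μ₀ κ =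
      processLaw μ₀ κ (avoiding A n) +
        ∫⁻ ω in avoiding A (n + 1), φ (ω (n + 1)) ∂processLaw μ₀ κ := by
  classical
  have hdrop : ∫⁻ ω in avoiding A (n + 1), φ (ω (n + 1)) ∂processLaw μ₀ κ =
      ∫⁻ ω in avoiding A n, φ (ω (n + 1)) ∂processLaw μ₀ κ := by
    rw [← lintegral_indicator (measurableSet_avoiding hA _),
      ← lintegral_indicator (measurableSet_avoiding hA _)]
    refine lintegral_congr fun ω => ?_
    by_cases hω : ω (n + 1) ∈ A <;> simp [Set.indicator_apply, mem_avoiding_succ_iff, hω, hφA]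
  calc ∫⁻ ω in avoiding A n, φ (ω n) ∂processLaw μ₀ κ
      = ∫⁻ ω in avoiding A n, 1 + ∫⁻ y, φ y ∂κ n (fun k => ω k) ∂processLaw μ₀ κ :=
        setLIntegral_congr_fun (measurableSet_avoiding hA n) fun ω hω =>
          (hstep (fun k => ω k) (hω n le_rfl)).symm
    _ = processLaw μ₀ κ (avoiding A n) +
          ∫⁻ ω in avoiding A (n + 1), φ (ω (n + 1)) ∂processLaw μ₀ κ := by
        rw [lintegral_add_left measurable_const, setLIntegral_one, hdrop,
          setLIntegral_avoiding_processLaw_succ μ₀ κ hA hφ]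

variable {κ}

lemma sum_measure_avoiding_add_setLIntegral (hA : MeasurableSet A) (hφ : Measurable φ)
    (hφA : ∀ x ∈ A, φ x = 0)
    (hstep : ∀ (n : ℕ) (h : Π _ : Finset.Iic n, E), h ⟨n, Finset.mem_Iic.2 le_rfl⟩ ∉ A →
      1 + ∫⁻ y, φ y ∂κ n h = φ (h ⟨n, Finset.mem_Iic.2 le_rfl⟩)) (n : ℕ) :
    ∑ k ∈ Finset.range n, processLaw μ₀ κ (avoiding A k) +
      ∫⁻ ω in avoiding A n, φ (ω n) ∂processLaw μ₀ κ =
        ∫⁻ x, φ x ∂μ₀ := by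
  induction n with
  | zero =>
    have hstart : (avoiding A 0).indicator (fun ω : ℕ → E => φ (ω 0)) = fun ω => φ (ω 0) :=
      Set.indicator_eq_self.2 fun ω hω k hk hkA => hω (hφA _ (Nat.le_zero.1 hk ▸ hkA))
    rw [Finset.sum_range_zero, zero_add, ← lintegral_indicator (measurableSet_avoiding hA 0),
      hstart, lintegral_processLaw_zero μ₀ κ hφ]
  | succ n ih =>
    rw [Finset.sum_range_succ, add_assoc,
      ← setLIntegral_avoiding_eq_measure_add μ₀ κ hA hφ hφA (hstep n), ih]

/-- Summing the first-step equation up to time `n` leaves the remainder `E[φ (ω n); avoiding A n]`,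
which is at most `C * P(avoiding A n)` and hence tends to `0`, these probabilities being summable.
Without the bound on `φ` the remainder may survive, e.g. for `φ = ∞` off `A`. -/
theorem lintegral_firstVisit_processLaw (hA : MeasurableSet A) (hφ : Measurable φ)
    {C : ℝ≥0∞} (hC : C ≠ ⊤) (hφC : ∀ x, φ x ≤ C) (hφA : ∀ x ∈ A, φ x = 0)
    (hstep : ∀ (n : ℕ) (h : Π _ : Finset.Iic n, E), h ⟨n, Finset.mem_Iic.2 le_rfl⟩ ∉ A →
      1 + ∫⁻ y, φ y ∂κ n h = φ (h ⟨n, Finset.mem_Iic.2 le_rfl⟩)) :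
    ∫⁻ ω, firstVisit A ω ∂processLaw μ₀ κ = ∫⁻ x, φ x ∂μ₀ := by
  have hpartial := sum_measure_avoiding_add_setLIntegral μ₀ hA hφ hφA hstep
  have hfinite : ∫⁻ x, φ x ∂μ₀ ≠ ⊤ :=
    ne_top_of_le_ne_top hC ((lintegral_mono hφC).trans_eq (by simp))
  have hsummable : ∑' n, processLaw μ₀ κ (avoiding A n) ≠ ⊤ := by
    refine ne_top_of_le_ne_top hfinite ?_
    rw [ENNReal.tsum_eq_iSup_nat]
    exact iSup_le fun n => le_self_add.trans (hpartial n).le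
  have hremainder :
      Tendsto (fun n => ∫⁻ ω in avoiding A n, φ (ω n) ∂processLaw μ₀ κ) atTop (𝓝 0) := by
    have hbound : Tendsto (fun n => C * processLaw μ₀ κ (avoiding A n)) atTop (𝓝 0) := by
      simpa using ENNReal.Tendsto.const_mul
        (ENNReal.tendsto_atTop_zero_of_tsum_ne_top hsummable) (.inr hC)
    refine tendsto_of_tendsto_of_tendsto_of_le_of_le tendsto_const_nhds hbound
      (fun _ => zero_le) fun n => ?_
    exact (lintegral_mono fun ω : ℕ → E => hφC (ω n)).trans_eq (setLIntegral_const _ _)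
  have hlimit := (ENNReal.tendsto_nat_tsum fun n => processLaw μ₀ κ (avoiding A n)).add hremainder
  simp_rw [add_zero] at hlimit
  rw [lintegral_firstVisit _ hA]
  exact tendsto_nhds_unique hlimit (tendsto_const_nhds.congr fun n => (hpartial n).symm)

end FirstStepEquation

section DistanceInTrees

variable {V : Type*} {G : SimpleGraph V}

lemma dist_map_le_dist {W : Type*} {H : SimpleGraph W} (hG : G.Connected) (hH : H.Connected)
    {f : V → W} (hf : ∀ x y, G.Adj x y → H.dist (f x) (f y) ≤ 1) (x y : V) :
    H.dist (f x) (f y) ≤ G.dist x y := by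
  obtain ⟨p, hp⟩ := hG.exists_walk_length_eq_dist x y
  rw [← hp]
  clear hp
  induction p with
  | nil => simp
  | @cons x x' y h p ih =>
    calc H.dist (f x) (f y) ≤ H.dist (f x) (f x') + H.dist (f x') (f y) := hH.dist_triangle
      _ ≤ 1 + p.length := add_le_add (hf _ _ h) ih
      _ = (SimpleGraph.Walk.cons h p).length := by rw [SimpleGraph.Walk.length_cons, add_comm]

lemma dist_eq_dist_add_one_of_adj_iff_eq {x y b : V} (hx : ∀ z, G.Adj x z ↔ z = y) (hb : b ≠ x)
    (hreach : G.Reachable x b) : G.dist x b = G.dist y b + 1 := by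
  have hxy : G.Adj x y := (hx y).2 rfl
  apply le_antisymm
  · obtain ⟨p, hp⟩ := (hxy.reachable.symm.trans hreach).exists_walk_length_eq_dist
    exact hp ▸ SimpleGraph.dist_le (.cons hxy p)
  · obtain ⟨p, hp⟩ := hreach.exists_walk_length_eq_dist
    cases p with
    | nil => exact absurd rfl hb
    | cons h p =>
      obtain rfl := (hx _).1 h
      exact hp ▸ Nat.succ_le_succ (SimpleGraph.dist_le p)

lemma existsUnique_adj_dist_add_one_eq_of_isTree (hG : G.IsTree) {z w : V} (hwz : w ≠ z) :
    ∃! x, G.Adj w x ∧ G.dist z x + 1 = G.dist z w := by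
  obtain ⟨p, hp, hplen⟩ := hG.connected.exists_path_of_dist w z
  cases p with
  | nil => exact absurd rfl hwz
  | @cons _ x _ h p =>
    refine ⟨x, ⟨h, ?_⟩, ?_⟩
    · have hle : G.dist z x ≤ p.length := SimpleGraph.dist_comm (G := G) ▸ SimpleGraph.dist_le p
      have hlen : p.length + 1 = G.dist z w := SimpleGraph.dist_comm (G := G) ▸ hplen
      have := hG.dist_eq_dist_add_one_of_adj z h
      omega
    · rintro y ⟨hy, hdist⟩
      obtain ⟨q, hq⟩ := hG.connected.exists_walk_length_eq_dist y z
      have hq' : (SimpleGraph.Walk.cons hy q).IsPath := by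
        refine SimpleGraph.Walk.isPath_of_length_eq_dist _ ?_
        rw [SimpleGraph.Walk.length_cons, hq, SimpleGraph.dist_comm, hdist, SimpleGraph.dist_comm]
      have hpaths := (hG.isAcyclic.subsingleton_path w z).elim ⟨_, hq'⟩ ⟨_, hp⟩
      simpa using congrArg (fun r => r.1.snd) hpaths

variable [Fintype V]

/-- The transmission of a vertex: the sum of its distances to all vertices. -/
noncomputable def transmission (G : SimpleGraph V) (v : V) : ℝ :=
  ∑ w, (G.dist v w : ℝ)

lemma transmission_le_add (hG : G.Connected) (u v : V) :
    transmission G u ≤ transmission G v + ((Fintype.card V : ℝ) - 1) * G.dist u v := by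
  classical
  have hterm : ∀ w, (G.dist u w : ℝ) ≤
      G.dist v w + (G.dist u v - if w = u then (G.dist u v : ℝ) else 0) := by
    intro w
    split_ifs with hw
    · subst hw
      simp
    · rw [sub_zero, add_comm]
      exact_mod_cast hG.dist_triangle
  refine (Finset.sum_le_sum fun w _ => hterm w).trans_eq ?_
  simp only [Finset.sum_add_distrib, Finset.sum_sub_distrib, Finset.sum_const, Finset.card_univ,
    nsmul_eq_mul, Finset.sum_ite_eq', Finset.mem_univ, if_true, transmission]
  ring

lemma transmission_eq_add_of_adj_iff_eq (hG : G.Connected) {x y : V}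
    (hx : ∀ z, G.Adj x z ↔ z = y) :
    transmission G x = transmission G y + Fintype.card V - 2 := by
  classical
  have hterm : ∀ b, (G.dist x b : ℝ) = G.dist y b + 1 - if b = x then 2 else 0 := by
    intro b
    split_ifs with hb
    · have hyx : G.dist y x = 1 := SimpleGraph.dist_eq_one_iff_adj.2 ((hx y).2 rfl).symm
      rw [hb, hyx, SimpleGraph.dist_self]
      norm_num
    · rw [dist_eq_dist_add_one_of_adj_iff_eq hx hb (hG x b)]
      push_cast
      ring
  simp only [transmission, hterm, Finset.sum_sub_distrib, Finset.sum_add_distrib, Finset.sum_const,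
    Finset.card_univ, nsmul_eq_mul, mul_one, Finset.sum_ite_eq', Finset.mem_univ, if_true]

lemma transmission_eq_sum_dist (G : SimpleGraph V) (v : V) :
    transmission G v = ∑ w, (G.dist w v : ℝ) :=
  Finset.sum_congr rfl fun w _ => by rw [G.dist_comm]

variable [DecidableRel G.Adj]

variable (G) in
lemma sum_sum_neighborFinset_sub_eq_zero {R : Type*} [AddCommGroup R] (φ : V → R) :
    ∑ w, ∑ x ∈ G.neighborFinset w, (φ x - φ w) = 0 := by
  have hswap : ∑ w, ∑ x ∈ G.neighborFinset w, φ x = ∑ w, ∑ _x ∈ G.neighborFinset w, φ w :=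
    Finset.sum_comm' fun w x => by simp [G.adj_comm]
  simp_rw [Finset.sum_sub_distrib, hswap, sub_self]

lemma isTree_iff_connected_and_sum_degree :
    G.IsTree ↔ G.Connected ∧ ∑ v, G.degree v + 2 = 2 * Fintype.card V := by
  rw [SimpleGraph.isTree_iff_connected_and_card, G.sum_degrees_eq_twice_card_edges,
    Nat.card_eq_fintype_card, Nat.card_eq_fintype_card, ← SimpleGraph.edgeFinset_card]
  exact and_congr_right fun _ => by omega

lemma sum_degree_of_isTree (hG : G.IsTree) :
    ∑ v, (G.degree v : ℝ) = 2 * ((Fintype.card V : ℝ) - 1) := by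
  have h : ∑ v, (G.degree v : ℝ) + 2 = 2 * Fintype.card V := by
    exact_mod_cast (isTree_iff_connected_and_sum_degree.1 hG).2
  linarith

/-- All neighbours of `w` are one step further from `z` than `w` is, except for a single one which
is one step closer if `w ≠ z`. -/
lemma sum_neighborFinset_dist_sub_of_isTree [DecidableEq V] (hG : G.IsTree) (z w : V) :
    ∑ x ∈ G.neighborFinset w, ((G.dist z x : ℝ) - G.dist z w) =
      G.degree w - 2 + if z = w then 2 else 0 := by
  have hterm : ∀ x ∈ G.neighborFinset w, (G.dist z x : ℝ) - G.dist z w =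
      1 - if G.dist z x + 1 = G.dist z w then 2 else 0 := by
    intro x hx
    rcases hG.dist_eq_dist_add_one_of_adj z ((G.mem_neighborFinset w x).1 hx) with h | h
    · rw [if_pos h.symm, h]
      push_cast
      ring
    · rw [if_neg (by omega), h]
      push_cast
      ring
  have hcloser : ({x ∈ G.neighborFinset w | G.dist z x + 1 = G.dist z w}.card : ℝ) =
      if z = w then 0 else 1 := by
    split_ifs with hzw
    · simp [hzw]
    · obtain ⟨x, hx, huniq⟩ := existsUnique_adj_dist_add_one_eq_of_isTree hG (Ne.symm hzw)
      rw [Nat.cast_eq_one, Finset.card_eq_one]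
      refine ⟨x, Finset.ext fun y => ?_⟩
      rw [Finset.mem_filter, G.mem_neighborFinset, Finset.mem_singleton]
      exact ⟨huniq y, fun hy => hy ▸ hx⟩
  rw [Finset.sum_congr rfl hterm, Finset.sum_sub_distrib, ← Finset.sum_filter, Finset.sum_const,
    Finset.sum_const, nsmul_eq_mul, nsmul_eq_mul, hcloser, G.card_neighborFinset_eq_degree]
  split_ifs <;> ring

lemma sum_neighborFinset_transmission_sub_of_isTree (hG : G.IsTree) (w : V) :
    ∑ x ∈ G.neighborFinset w, (transmission G x - transmission G w) =
      Fintype.card V * ((G.degree w : ℝ) - 2) + 2 := by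
  classical
  calc ∑ x ∈ G.neighborFinset w, (transmission G x - transmission G w)
      = ∑ z, ∑ x ∈ G.neighborFinset w, ((G.dist z x : ℝ) - G.dist z w) := by
        simp_rw [transmission_eq_sum_dist, ← Finset.sum_sub_distrib]
        exact Finset.sum_comm
    _ = ∑ z, ((G.degree w : ℝ) - 2 + if z = w then 2 else 0) :=
        Finset.sum_congr rfl fun z _ => sum_neighborFinset_dist_sub_of_isTree hG z w
    _ = Fintype.card V * ((G.degree w : ℝ) - 2) + 2 := by
        rw [Finset.sum_add_distrib, Finset.sum_const, Finset.card_univ, nsmul_eq_mul,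
          Finset.sum_ite_eq', if_pos (Finset.mem_univ w)]

lemma sum_degree_mul_dist_of_isTree (hG : G.IsTree) (z : V) :
    ∑ w, (G.degree w : ℝ) * G.dist z w = 2 * transmission G z - ((Fintype.card V : ℝ) - 1) := by
  classical
  have hstep : ∀ w, ∀ x ∈ G.neighborFinset w, (G.dist z x : ℝ) ^ 2 - (G.dist z w : ℝ) ^ 2 =
      2 * G.dist z w * ((G.dist z x : ℝ) - G.dist z w) + 1 := by
    intro w x hx
    rcases hG.dist_eq_dist_add_one_of_adj z ((G.mem_neighborFinset w x).1 hx) with h | h <;>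
    · rw [h]
      push_cast
      ring
  have hlaplacian : ∀ w, ∑ x ∈ G.neighborFinset w, ((G.dist z x : ℝ) ^ 2 - (G.dist z w : ℝ) ^ 2) =
      2 * ((G.degree w : ℝ) * G.dist z w) - 4 * G.dist z w + G.degree w := by
    intro w
    rw [Finset.sum_congr rfl (hstep w), Finset.sum_add_distrib, ← Finset.mul_sum,
      sum_neighborFinset_dist_sub_of_isTree hG, Finset.sum_const, nsmul_one,
      G.card_neighborFinset_eq_degree]
    split_ifs with hzw
    · simp [hzw]
    · ring
  have hzero := sum_sum_neighborFinset_sub_eq_zero G fun w => (G.dist z w : ℝ) ^ 2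
  simp_rw [hlaplacian, Finset.sum_add_distrib, Finset.sum_sub_distrib, ← Finset.mul_sum,
    sum_degree_of_isTree hG] at hzero
  rw [transmission]
  linarith

lemma sum_degree_mul_transmission_of_isTree (hG : G.IsTree) :
    ∑ w, (G.degree w : ℝ) * transmission G w =
      2 * ∑ z, transmission G z - Fintype.card V * ((Fintype.card V : ℝ) - 1) := by
  calc ∑ w, (G.degree w : ℝ) * transmission G w
      = ∑ z, ∑ w, (G.degree w : ℝ) * G.dist z w := by
        simp_rw [transmission_eq_sum_dist, Finset.mul_sum]
        exact Finset.sum_comm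
    _ = 2 * ∑ z, transmission G z - Fintype.card V * ((Fintype.card V : ℝ) - 1) := by
        simp_rw [sum_degree_mul_dist_of_isTree hG, Finset.sum_sub_distrib, ← Finset.mul_sum,
          Finset.sum_const, Finset.card_univ, nsmul_eq_mul]
        ring

end DistanceInTrees

namespace FinGraph

section HittingTimes

variable (T : FinGraph.{u})

lemma hittingTime_eq_of_first_step {v : T.V} {φ : T.V → ℝ≥0∞} (hfinite : ∀ w, φ w ≠ ⊤)
    (hv : φ v = 0) (hstep : ∀ w, w ≠ v → 1 + ∫⁻ y, φ y ∂(T.stepPMF w).toMeasure = φ w) (u : T.V) :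
    T.hittingTime u v = φ u := by
  have hvisit := lintegral_firstVisit_processLaw (.dirac u) (κ := T.stepKernel) (A := {v})
    (measurableSet_singleton v) (measurable_of_countable φ)
    (ENNReal.sum_ne_top.2 fun w _ => hfinite w)
    (fun w => Finset.single_le_sum (fun _ _ => zero_le) (Finset.mem_univ w))
    (fun w hw => (congrArg φ hw).trans hv) fun _ h hh => hstep _ hh
  rwa [lintegral_dirac] at hvisit

lemma lintegral_stepPMF [DecidableRel T.graph.Adj] {w : T.V} (hw : 0 < T.graph.degree w)
    (φ : T.V → ℝ≥0∞) :
    ∫⁻ y, φ y ∂(T.stepPMF w).toMeasure =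
      (∑ y ∈ T.graph.neighborFinset w, φ y) / T.graph.degree w := by
  classical
  have hne : (T.graph.neighborFinset w).Nonempty := by
    rwa [← Finset.card_pos, SimpleGraph.card_neighborFinset_eq_degree]
  have hstep : T.stepPMF w = PMF.uniformOfFinset (T.graph.neighborFinset w) hne := by
    rw [stepPMF, dif_pos (by convert hne)]
    congr!
  simp_rw [lintegral_fintype, PMF.toMeasure_apply_singleton _ _ (MeasurableSet.singleton _), hstep,
    PMF.uniformOfFinset_apply, mul_ite, mul_zero]
  rw [Finset.sum_ite_mem, Finset.univ_inter, ← Finset.sum_mul, ENNReal.div_eq_inv_mul, mul_comm,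
    SimpleGraph.card_neighborFinset_eq_degree]

lemma hittingTime_eq_ofReal_of_sum_sub_eq_neg_degree [DecidableRel T.graph.Adj] {v : T.V}
    {ψ : T.V → ℝ} (hψ : ∀ w, 0 ≤ ψ w) (hv : ψ v = 0)
    (hdegree : ∀ w, w ≠ v → 0 < T.graph.degree w)
    (hlaplacian : ∀ w, w ≠ v →
      ∑ x ∈ T.graph.neighborFinset w, (ψ x - ψ w) = -(T.graph.degree w : ℝ)) (u : T.V) :
    T.hittingTime u v = ENNReal.ofReal (ψ u) := by
  refine T.hittingTime_eq_of_first_step (φ := fun w => ENNReal.ofReal (ψ w))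
    (fun _ => ENNReal.ofReal_ne_top) (by rw [hv, ENNReal.ofReal_zero]) (fun w hw => ?_) u
  have hpos : (0 : ℝ) < T.graph.degree w := Nat.cast_pos.2 (hdegree w hw)
  have hsum : 0 ≤ ∑ x ∈ T.graph.neighborFinset w, ψ x := Finset.sum_nonneg fun x _ => hψ x
  have haverage : 1 + (∑ x ∈ T.graph.neighborFinset w, ψ x) / T.graph.degree w = ψ w := by
    have h := hlaplacian w hw
    rw [Finset.sum_sub_distrib, Finset.sum_const, T.graph.card_neighborFinset_eq_degree,
      nsmul_eq_mul] at h
    field_simp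
    linarith
  rw [T.lintegral_stepPMF (hdegree w hw), ← ENNReal.ofReal_sum_of_nonneg fun x _ => hψ x,
    ← ENNReal.ofReal_natCast, ← ENNReal.ofReal_div_of_pos hpos, ← ENNReal.ofReal_one,
    ← ENNReal.ofReal_add zero_le_one (div_nonneg hsum hpos.le), haverage]

variable {T}

theorem hittingTime_of_isTree (hT : T.graph.IsTree) (u v : T.V) :
    T.hittingTime u v = ENNReal.ofReal (((T.order : ℝ) - 1) * T.graph.dist u v +
      transmission T.graph v - transmission T.graph u) := by
  classical
  simp_rw [T.graph.dist_comm (u := u)]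
  refine T.hittingTime_eq_ofReal_of_sum_sub_eq_neg_degree (v := v)
    (ψ := fun w => ((T.order : ℝ) - 1) * T.graph.dist v w + transmission T.graph v -
      transmission T.graph w) (fun w => ?_) ?_ (fun w hw => ?_) (fun w hw => ?_) u
  · have h := transmission_le_add hT.connected w v
    rw [T.graph.dist_comm] at h
    rw [order]
    linarith
  · simp
  · have := nontrivial_of_ne w v hw
    exact hT.connected.preconnected.degree_pos_of_nontrivial w
  · calc ∑ x ∈ T.graph.neighborFinset w, _
        = ((T.order : ℝ) - 1) *
              ∑ x ∈ T.graph.neighborFinset w, ((T.graph.dist v x : ℝ) - T.graph.dist v w) -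
            ∑ x ∈ T.graph.neighborFinset w,
              (transmission T.graph x - transmission T.graph w) := by
          rw [Finset.mul_sum, ← Finset.sum_sub_distrib]
          exact Finset.sum_congr rfl fun x _ => by ring
      _ = -(T.graph.degree w : ℝ) := by
          rw [sum_neighborFinset_dist_sub_of_isTree hT, if_neg hw.symm,
            sum_neighborFinset_transmission_sub_of_isTree hT, order]
          ring

lemma toReal_hittingTime_of_isTree (hT : T.graph.IsTree) (u v : T.V) :
    (T.hittingTime u v).toReal =
      ((T.order : ℝ) - 1) * T.graph.dist u v + transmission T.graph v - transmission T.graph u := by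
  have h := transmission_le_add hT.connected u v
  rw [hittingTime_of_isTree hT, ENNReal.toReal_ofReal (by rw [order]; linarith)]

lemma wiener_eq_half_sum_transmission : T.wiener = 1 / 2 * ∑ v, transmission T.graph v :=
  rfl

theorem meanHittingTime_of_isTree (hT : T.graph.IsTree) (h2 : 2 ≤ T.order) :
    T.meanHittingTime = 2 / (T.order : ℝ) * T.wiener := by
  have h2' : (2 : ℝ) ≤ T.order := mod_cast h2
  have hsum : ∑ u, ∑ v, (T.hittingTime u v).toReal = ((T.order : ℝ) - 1) * (2 * T.wiener) := by
    have hcancel : ∑ _u : T.V, ∑ v : T.V, transmission T.graph v =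
        ∑ u : T.V, ∑ _v : T.V, transmission T.graph u := Finset.sum_comm
    simp_rw [toReal_hittingTime_of_isTree hT, Finset.sum_sub_distrib, Finset.sum_add_distrib,
      hcancel, ← Finset.mul_sum, wiener]
    ring
  have hne : (T.order : ℝ) - 1 ≠ 0 := by linarith
  rw [meanHittingTime, hsum]
  field_simp

end HittingTimes

section Growth

variable {T : FinGraph.{u}} {m : ℕ}

/-- The copy in `growII m T` of the vertex `u` of `T`. -/
def oldVertex (m : ℕ) {T : FinGraph.{u}} (u : T.V) : (growII m T).V :=
  Sum.inl u

/-- The `i`-th leaf of `growII m T` attached to the vertex `u` of `T`. -/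
def newLeaf {u : T.V} (i : Fin (m * T.deg u)) : (growII m T).V :=
  Sum.inr ⟨u, i⟩

/-- The retraction of `growII m T` onto `T` sending each new leaf to the vertex it is
attached to. -/
def root : (growII m T).V → T.V :=
  Sum.elim id Sigma.fst

lemma oldVertex_injective : Function.Injective (oldVertex m (T := T)) :=
  Sum.inl_injective

lemma forall_growII {p : (growII m T).V → Prop} :
    (∀ a, p a) ↔ (∀ u, p (oldVertex m u)) ∧ ∀ u (i : Fin (m * T.deg u)), p (newLeaf i) :=
  ⟨fun h => ⟨fun _ => h _, fun _ _ => h _⟩, fun h => by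
    rintro (u | ⟨u, i⟩)
    exacts [h.1 u, h.2 u i]⟩

lemma sum_growII {R : Type*} [AddCommMonoid R] (f : (growII m T).V → R) :
    ∑ a, f a = ∑ u, (f (oldVertex m u) + ∑ i : Fin (m * T.deg u), f (newLeaf i)) := by
  rw [Finset.sum_add_distrib, ← Fintype.sum_sigma' fun u (i : Fin (m * T.deg u)) => f (newLeaf i)]
  exact Fintype.sum_sum_type f

lemma growII_adj_oldVertex_iff {u v : T.V} :
    (growII m T).graph.Adj (oldVertex m u) (oldVertex m v) ↔ T.graph.Adj u v :=
  ⟨fun h => by cases h with | old h => exact h, .old⟩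

lemma growII_adj_newLeaf_iff {u : T.V} {i : Fin (m * T.deg u)} {b : (growII m T).V} :
    (growII m T).graph.Adj (newLeaf i) b ↔ b = oldVertex m u :=
  ⟨fun h => by cases h; rfl, fun h => h ▸ .up u i⟩

lemma deg_eq_degree (u : T.V) [Fintype (T.graph.neighborSet u)] : T.deg u = T.graph.degree u := by
  rw [deg]
  congr!

lemma deg_eq_sum [DecidableRel T.graph.Adj] (u : T.V) :
    T.deg u = ∑ v, if T.graph.Adj u v then 1 else 0 := by
  simpa [deg_eq_degree] using SimpleGraph.degree_eq_sum_if_adj (R := ℕ) (G := T.graph) u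

lemma deg_oldVertex (u : T.V) : (growII m T).deg (oldVertex m u) = (m + 1) * T.deg u := by
  classical
  have hleaf : ∀ v (i : Fin (m * T.deg v)),
      (growII m T).graph.Adj (oldVertex m u) (newLeaf i) ↔ u = v := fun v i => by
    rw [SimpleGraph.adj_comm, growII_adj_newLeaf_iff, oldVertex_injective.eq_iff]
  simp_rw [deg_eq_sum (oldVertex m u), sum_growII, growII_adj_oldVertex_iff, hleaf,
    Finset.sum_add_distrib, ← deg_eq_sum]
  simp [add_mul, add_comm]

lemma deg_newLeaf {u : T.V} (i : Fin (m * T.deg u)) : (growII m T).deg (newLeaf i) = 1 := by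
  classical
  simp_rw [deg_eq_sum, growII_adj_newLeaf_iff]
  simp

lemma order_growII : (growII m T).order = T.order + m * ∑ u, T.deg u := by
  have hcard : (growII m T).order = ∑ _a : (growII m T).V, 1 := Fintype.card_eq_sum_ones
  rw [hcard, sum_growII, order]
  simp [Finset.sum_add_distrib, Finset.mul_sum]

lemma sum_deg_growII : ∑ a, (growII m T).deg a = (2 * m + 1) * ∑ u, T.deg u := by
  simp_rw [sum_growII, deg_oldVertex, deg_newLeaf, Finset.sum_const, Finset.card_univ,
    Fintype.card_fin, smul_eq_mul, Finset.mul_sum]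
  exact Finset.sum_congr rfl fun u _ => by ring

lemma connected_growII (hT : T.graph.Connected) : (growII m T).graph.Connected := by
  have hold : ∀ u v : T.V, (growII m T).graph.Reachable (oldVertex m u) (oldVertex m v) :=
    fun u v => (hT u v).map ⟨oldVertex m, growII_adj_oldVertex_iff.2⟩
  have hroot : ∀ a : (growII m T).V, (growII m T).graph.Reachable a (oldVertex m (root a)) :=
    forall_growII.2 ⟨fun u => .rfl, fun u i => (growII_adj_newLeaf_iff.2 rfl).reachable⟩
  have := hT.nonempty.map (oldVertex m)
  exact ⟨fun a b => (hroot a).trans ((hold _ _).trans (hroot b).symm)⟩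

lemma isTree_iff_connected_and_sum_deg :
    T.graph.IsTree ↔ T.graph.Connected ∧ ∑ u, T.deg u + 2 = 2 * T.order := by
  classical
  simp_rw [deg_eq_degree]
  exact isTree_iff_connected_and_sum_degree

theorem isTree_growII (hT : T.graph.IsTree) : (growII m T).graph.IsTree := by
  obtain ⟨hconn, hsum⟩ := isTree_iff_connected_and_sum_deg.1 hT
  refine isTree_iff_connected_and_sum_deg.2 ⟨connected_growII hconn, ?_⟩
  rw [sum_deg_growII, order_growII]
  linarith

lemma dist_oldVertex (hT : T.graph.Connected) (u v : T.V) :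
    (growII m T).graph.dist (oldVertex m u) (oldVertex m v) = T.graph.dist u v := by
  apply le_antisymm
  · exact dist_map_le_dist hT (connected_growII hT) (fun x y h =>
      (SimpleGraph.dist_eq_one_iff_adj.2 (growII_adj_oldVertex_iff.2 h)).le) u v
  · refine dist_map_le_dist (f := root) (connected_growII hT) hT (fun a b h => ?_)
      (oldVertex m u) (oldVertex m v)
    cases h with
    | old h => exact (SimpleGraph.dist_eq_one_iff_adj.2 h).le
    | down u i => exact SimpleGraph.dist_self.trans_le zero_le_one
    | up u i => exact SimpleGraph.dist_self.trans_le zero_le_one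

lemma dist_oldVertex_newLeaf (hT : T.graph.Connected) (u : T.V) {v : T.V}
    (i : Fin (m * T.deg v)) :
    (growII m T).graph.dist (oldVertex m u) (newLeaf i) = T.graph.dist u v + 1 := by
  have hne : oldVertex m u ≠ newLeaf i := Sum.inl_ne_inr
  rw [SimpleGraph.dist_comm, dist_eq_dist_add_one_of_adj_iff_eq (fun _ => growII_adj_newLeaf_iff)
    hne (connected_growII hT _ _), dist_oldVertex hT, SimpleGraph.dist_comm]

lemma sum_deg_of_isTree (hT : T.graph.IsTree) :
    ∑ u, (T.deg u : ℝ) = 2 * ((T.order : ℝ) - 1) := by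
  classical
  simp_rw [deg_eq_degree]
  exact sum_degree_of_isTree hT

lemma order_growII_of_isTree (hT : T.graph.IsTree) :
    ((growII m T).order : ℝ) = (2 * m + 1) * ((T.order : ℝ) - 1) + 1 := by
  rw [order_growII]
  push_cast
  rw [sum_deg_of_isTree hT]
  ring

lemma transmission_oldVertex (hT : T.graph.IsTree) (u : T.V) :
    transmission (growII m T).graph (oldVertex m u) =
      (2 * m + 1) * transmission T.graph u + m * ((T.order : ℝ) - 1) := by
  have hdist : ∑ v, (T.deg v : ℝ) * T.graph.dist u v =
      2 * transmission T.graph u - ((T.order : ℝ) - 1) := by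
    classical
    simp_rw [deg_eq_degree]
    exact sum_degree_mul_dist_of_isTree hT u
  calc transmission (growII m T).graph (oldVertex m u)
      = ∑ v, ((T.graph.dist u v : ℝ) + m * T.deg v * (T.graph.dist u v + 1)) := by
        simp [transmission, sum_growII, dist_oldVertex hT.connected,
          dist_oldVertex_newLeaf hT.connected, mul_add]
    _ = transmission T.graph u + m * ∑ v, (T.deg v : ℝ) * T.graph.dist u v +
          m * ∑ v, (T.deg v : ℝ) := by
        rw [transmission, Finset.mul_sum, Finset.mul_sum, ← Finset.sum_add_distrib,
          ← Finset.sum_add_distrib]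
        exact Finset.sum_congr rfl fun v _ => by ring
    _ = (2 * m + 1) * transmission T.graph u + m * ((T.order : ℝ) - 1) := by
        rw [hdist, sum_deg_of_isTree hT]
        ring

lemma transmission_newLeaf (hT : T.graph.Connected) {u : T.V} (i : Fin (m * T.deg u)) :
    transmission (growII m T).graph (newLeaf i) =
      transmission (growII m T).graph (oldVertex m u) + (growII m T).order - 2 :=
  transmission_eq_add_of_adj_iff_eq (connected_growII hT) fun _ => growII_adj_newLeaf_iff

lemma sum_deg_mul_transmission_of_isTree (hT : T.graph.IsTree) :
    ∑ u, (T.deg u : ℝ) * transmission T.graph u =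
      4 * T.wiener - T.order * ((T.order : ℝ) - 1) := by
  classical
  simp_rw [deg_eq_degree]
  rw [sum_degree_mul_transmission_of_isTree hT, wiener_eq_half_sum_transmission, order]
  ring

theorem wiener_growII (hT : T.graph.IsTree) :
    (growII m T).wiener = (2 * m + 1) ^ 2 * T.wiener + (m * (2 * m + 1) * (T.order : ℝ) ^ 2 -
      m * (5 * m + 3) * T.order + m * (3 * m + 2)) := by
  have hsum : ∑ a, transmission (growII m T).graph a =
      (2 * m + 1) * ∑ u, transmission T.graph u + T.order * (m * ((T.order : ℝ) - 1)) +
        m * (2 * m + 1) * ∑ u, (T.deg u : ℝ) * transmission T.graph u +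
        m * (m * ((T.order : ℝ) - 1) + (growII m T).order - 2) * ∑ u, (T.deg u : ℝ) := by
    simp_rw [sum_growII, transmission_newLeaf hT.connected, transmission_oldVertex hT,
      Finset.sum_const, Finset.card_univ, Fintype.card_fin, nsmul_eq_mul]
    have hcard : (T.order : ℝ) * (m * ((T.order : ℝ) - 1)) =
        ∑ _u : T.V, m * ((T.order : ℝ) - 1) := by
      rw [Finset.sum_const, Finset.card_univ, nsmul_eq_mul, order]
    rw [hcard]
    simp_rw [Finset.mul_sum, ← Finset.sum_add_distrib]
    refine Finset.sum_congr rfl fun u _ => ?_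
    push_cast
    ring
  have hwiener : ∑ u, transmission T.graph u = 2 * T.wiener := by
    rw [wiener_eq_half_sum_transmission]
    ring
  rw [wiener_eq_half_sum_transmission, hsum, sum_deg_mul_transmission_of_isTree hT,
    sum_deg_of_isTree hT, order_growII_of_isTree hT, hwiener]
  ring

theorem isTree_treeII (hT : T.graph.IsTree) (t : ℕ) : (T.treeII m t).graph.IsTree := by
  induction t with
  | zero => exact hT
  | succ t ih => exact isTree_growII ih

theorem order_treeII (hT : T.graph.IsTree) (t : ℕ) :
    ((T.treeII m t).order : ℝ) = ((T.order : ℝ) - 1) * (2 * (m : ℝ) + 1) ^ t + 1 := by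
  induction t with
  | zero => simp [treeII]
  | succ t ih =>
    rw [treeII, order_growII_of_isTree (isTree_treeII hT t), ih]
    ring

lemma order_le_order_treeII (m t : ℕ) : T.order ≤ (T.treeII m t).order := by
  induction t with
  | zero => exact le_rfl
  | succ t ih => exact ih.trans (order_growII.symm ▸ Nat.le_add_right _ _)

theorem wiener_treeII (hT : T.graph.IsTree) (t : ℕ) :
    (T.treeII m t).wiener = ((2 * (m : ℝ) + 1) ^ 2) ^ t * T.wiener
      + m * (2 * m + 1) * ∑ i ∈ Finset.range t,
          ((2 * (m : ℝ) + 1) ^ 2) ^ i * ((T.treeII m (t - 1 - i)).order : ℝ) ^ 2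
      - m * (5 * m + 3) * ∑ i ∈ Finset.range t,
          ((2 * (m : ℝ) + 1) ^ 2) ^ i * ((T.treeII m (t - 1 - i)).order : ℝ)
      + m * (3 * m + 2) * ∑ i ∈ Finset.range t, ((2 * (m : ℝ) + 1) ^ 2) ^ i := by
  rw [eq_pow_mul_add_sum_of_succ_eq (x := fun t => (T.treeII m t).wiener)
    fun t => wiener_growII (isTree_treeII hT t)]
  simp_rw [Finset.mul_sum, add_sub_assoc, add_assoc, ← Finset.sum_sub_distrib,
    ← Finset.sum_add_distrib]
  exact congrArg _ (Finset.sum_congr rfl fun i _ => by ring)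

end Growth

end FinGraph

theorem propositionI10 (T : FinGraph.{u}) (hT : T.graph.IsTree) (n : ℕ) (hn : T.order = n)
    (hn2 : 2 ≤ n) (m : ℕ) (f g h l : ℝ)
    (hf : f = (2 * (m : ℝ) + 1) ^ 2) (hg : g = (m : ℝ) * (2 * m + 1))
    (hh : h = (m : ℝ) * (5 * m + 3)) (hl : l = (m : ℝ) * (3 * m + 2)) (t : ℕ) :
    (T.treeII m t).graph.IsTree ∧
    ((T.treeII m t).order : ℝ) = ((n : ℝ) - 1) * (2 * (m : ℝ) + 1) ^ t + 1 ∧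
    (∀ u v : (T.treeII m t).V, (T.treeII m t).hittingTime u v ≠ ⊤) ∧
    (T.treeII m t).meanHittingTime =
      2 / ((T.treeII m t).order : ℝ) *
        (f ^ t * T.wiener
          + g * ∑ i ∈ Finset.range t, f ^ i * ((T.treeII m (t - 1 - i)).order : ℝ) ^ 2
          - h * ∑ i ∈ Finset.range t, f ^ i * ((T.treeII m (t - 1 - i)).order : ℝ)
          + l * ∑ i ∈ Finset.range t, f ^ i) := by
  subst hn hf hg hh hl
  have htree := FinGraph.isTree_treeII (m := m) hT t
  refine ⟨htree, FinGraph.order_treeII hT t, fun u v => ?_, ?_⟩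
  · rw [FinGraph.hittingTime_of_isTree htree]
    exact ENNReal.ofReal_ne_top
  · rw [FinGraph.meanHittingTime_of_isTree htree (hn2.trans (FinGraph.order_le_order_treeII m t)),
      FinGraph.wiener_treeII hT t]
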